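/- **Corollary (asymptotic normality of \(\hat\rho\)).** Let \((X_n,Y_n)_{n\ge 1}\) be independent, identically distributed pairs of real random variables with an arbitrary joint distribution \(P\) (ties and dependence between \(X_n\) and \(Y_n\) are allowed). For a sample \(x=(x_1,\dots,x_N)\) let \(C_{kl}(x)=1\) if \(k\neq l\) and \(x_k\ge x_l\), \(C_{kl}(x)=-1\) if \(k\ne l\) and \(x_k<x_l\), and \(C_{kk}(x)=0\). Put \[ \tilde\kappa_{kl}(x)=C_{kl}-\frac1{N-1}\sum_{j}C_{kj}-\frac1{N-1}\sum_{i}C_{il}+\frac1{N^2-N}\sum_{i,j}C_{ij},\qquad \underline{x}_l=\sum_{k=1}^N\tilde\kappa_{kl}(x), \] so that \(\underline x\) is the rank-transformed sample (for \(N\ge2\), \(\underline x_l=\frac{1}{N-1}\left(\#\{k\ne l: x_k<x_l\}-\#\{k\neq l: x_k\ge x_l\}\right)\)). Let \(\bar{\underline X},\bar{\underline Y}\) be the arithmetic means of \(\underline X,\underline Y\), and define the sample central joint moments \[ \hat\mu_{a,b}=\frac1{N-1}\sum_{n=1}^N(\underline X_n-\bar{\underline X})^a(\underline Y_n-\bar{\underline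 Y})^b . \] For fixed real weights \(\lambda_{a,b}\) let \[ \hat\rho_N=\sum_{r=2}^{4}\ \sum_{a+b=r}\lambda_{a,b}\,\hat\mu_{a,b},\qquad \rho=\sum_{r=2}^{4}\ \sum_{a+b=r}\lambda_{a,b}\,\mu_{a,b}, \] where, writing \(u(t)=\Pr(X_1<t)-\Pr(X_1\ge t)\) and \(v(t)=\Pr(Y_1<t)-\Pr(Y_1\ge t)\) for the population rank transformations, \(\mu_{a,b}=\mathbb E\big[(u(X_1)-\mathbb E\,u(X_1))^a\,(v(Y_1)-\mathbb E\,v(Y_1))^b\big]\) are the population central joint moments. Then the asymptotic variance \(\sigma^2=\lim_{N\to\infty}N\operatorname{Var}(\hat\rho_N)\in[0,\infty)\) exists, and \[ \sqrt N\,(\hat\rho_N-\rho)\ \xrightarrow{d}\ \mathcal N(0,\sigma^2)\qquad (N\to\infty), \] that is, \(\hat\rho_N\) is asymptotically \(\mathcal N(\rho,\sigma^2/N)\), where \(\mathcal N(0,0)\) denotes the point mass at \(0\). -/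

import Mathlib

open MeasureTheory ProbabilityTheory Filter Topology
open scoped NNReal

noncomputable section

namespace RankCorr

/-- The hollow score matrix of a sample `x`: off the diagonal the entry is `1` if `x k ≥ x l`
and `-1` if `x k < x l`; the diagonal is zero. -/
def score {N : ℕ} (x : Fin N → ℝ) (k l : Fin N) : ℝ :=
  if k = l then 0 else if x l ≤ x k then 1 else -1

/-- Row means of the score matrix (over the `N - 1` off-diagonal entries). -/
def rowMean {N : ℕ} (x : Fin N → ℝ) (k : Fin N) : ℝ :=
  (∑ l, score x k l) / ((N : ℝ) - 1)

/-- Column means of the score matrix (over the `N - 1` off-diagonal entries). -/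
def colMean {N : ℕ} (x : Fin N → ℝ) (l : Fin N) : ℝ :=
  (∑ k, score x k l) / ((N : ℝ) - 1)

/-- Grand mean of the score matrix (over the `N ^ 2 - N` off-diagonal entries). -/
def grandMean {N : ℕ} (x : Fin N → ℝ) : ℝ :=
  (∑ k, ∑ l, score x k l) / ((N : ℝ) ^ 2 - N)

/-- The doubly centred score matrix. -/
def centredScore {N : ℕ} (x : Fin N → ℝ) (k l : Fin N) : ℝ :=
  score x k l - rowMean x k - colMean x l + grandMean x

/-- The rank transformation: the vector of column sums of the centred score matrix. -/
def rankTransform {N : ℕ} (x : Fin N → ℝ) (l : Fin N) : ℝ :=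
  ∑ k, centredScore x k l

/-- Closed form: the proportion of the other observations that are strictly below `x l`, minus the
proportion of those that are at or above it. -/
theorem rankTransform_eq {N : ℕ} (hN : 2 ≤ N) (x : Fin N → ℝ) (l : Fin N) :
    rankTransform x l = (∑ k, -score x k l) / ((N : ℝ) - 1) := by
  have h2 : (2 : ℝ) ≤ N := by exact_mod_cast hN
  have h1 : (N : ℝ) - 1 ≠ 0 := by linarith
  have h0 : (N : ℝ) ≠ 0 := by linarith
  have h3 : (N : ℝ) ^ 2 - N ≠ 0 := by
    have : (N : ℝ) ^ 2 - N = N * (N - 1) := by ring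
    rw [this]; exact mul_ne_zero h0 h1
  simp only [rankTransform, centredScore, rowMean, colMean, grandMean, Finset.sum_add_distrib,
    Finset.sum_sub_distrib, Finset.sum_const, Finset.card_univ, Fintype.card_fin, nsmul_eq_mul,
    ← Finset.sum_div, Finset.sum_neg_distrib]
  field_simp
  ring

/-- The arithmetic mean of a vector. -/
def mean {N : ℕ} (u : Fin N → ℝ) : ℝ := (∑ n, u n) / N

/-- The sample central joint moment with exponents `(a, b)` of the rank-transformed data, normalised
by `N - 1`. -/
def sampleJointMoment (a b : ℕ) {N : ℕ} (x y : Fin N → ℝ) : ℝ :=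
  (∑ n, (rankTransform x n - mean (rankTransform x)) ^ a *
    (rankTransform y n - mean (rankTransform y)) ^ b) / ((N : ℝ) - 1)

/-- The estimator: the linear combination, with weights `w a b`, of the sample joint moments of
orders `a + b = r`, for `r = 2, 3, 4`. -/
def rhoHat (w : ℕ → ℕ → ℝ) {N : ℕ} (x y : Fin N → ℝ) : ℝ :=
  ∑ r ∈ Finset.Icc 2 4, ∑ p ∈ Finset.HasAntidiagonal.antidiagonal r, w p.1 p.2 * sampleJointMoment p.1 p.2 x y

/-- The population rank transformation for the distribution `ν`: the probability of an observation
strictly below `t`, minus that of an observation at or above `t`. -/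
def popRank (ν : Measure ℝ) (t : ℝ) : ℝ := ν.real (Set.Iio t) - ν.real (Set.Ici t)

/-- The population central joint moment with exponents `(a, b)` of the rank-transformed pair, for a
joint distribution `P`. -/
def popJointMoment (P : Measure (ℝ × ℝ)) (a b : ℕ) : ℝ :=
  ∫ p, (popRank P.fst p.1 - ∫ t, popRank P.fst t ∂P.fst) ^ a *
    (popRank P.snd p.2 - ∫ t, popRank P.snd t ∂P.snd) ^ b ∂P

/-- The true parameter: the same linear combination of the population joint moments. -/
def rho (w : ℕ → ℕ → ℝ) (P : Measure (ℝ × ℝ)) : ℝ :=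
  ∑ r ∈ Finset.Icc 2 4, ∑ p ∈ Finset.HasAntidiagonal.antidiagonal r, w p.1 p.2 * popJointMoment P p.1 p.2

end RankCorr

end

/-! Write c(s,t) = 1 if s < t and -1 otherwise. For N ≥ 2 the centred rank of observation l is
N/(N-1) times the average over all pairs (k,m) of c(x_k,x_l) - c(x_k,x_m). A sample moment of
exponents (a,b) is therefore (N/(N-1))^(a+b+1) times a V-statistic with a bounded kernel in 1 +
2(a+b) arguments, whose mean under the product law is the population moment (`sampleJointMoment_eq`,
`integral_blockKernel_momentFactor`). Ties and dependence play no role, because only boundedness and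
measurability of the kernel matter.

A V-statistic is its mean, plus the sample average of an influence function, plus a V-statistic
whose kernel has mean zero once any single argument is fixed. In the second moment of this
remainder, a pair of index maps can contribute only if it shows two independent coincidences. Such
pairs make up a fraction O(N⁻²) of all pairs, so the remainder is O(N⁻²) in mean square
(`integral_mul_eq_zero`, `exists_coincidence`, `sq_mul_integral_sum_sq_le`).

After scaling by √N, the statistic thus differs from a normalised i.i.d. sum by an error vanishing
in L². This property (`IsAsympLinear`) survives linear combinations and factors 1 + o(N^(-1/2)).
Convergence in L² carries over both the limit of the variances and the central limit theorem, so σ²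
is the variance of the combined influence function. When that variance is zero, the limit law is the
point mass. -/

namespace VStatistic

open Finset

/-! ### Product measures and orthogonality of degenerate kernels. -/

variable {E ι κ : Type*} [MeasurableSpace E] [Fintype ι] [Fintype κ]

/-- Selecting coordinates along an injective map preserves powers of a probability measure. -/
theorem measurePreserving_comp_injective (P : Measure E) [IsProbabilityMeasure P]
    {g : ι → κ} (hg : Function.Injective g) :
    MeasurePreserving (fun z : κ → E => z ∘ g) (Measure.pi fun _ => P)
      (Measure.pi fun _ => P) := by
  refine ⟨by fun_prop, ?_⟩
  have h := iIndepFun_pi (μ := fun _ : κ => P) (X := fun _ => id) (fun _ => aemeasurable_id)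
  have h' := (iIndepFun_iff_map_fun_eq_pi_map
    (fun i => (measurable_pi_apply (g i)).aemeasurable)).1 (h.precomp hg)
  refine h'.trans ?_
  congr 1
  funext i
  exact (measurePreserving_eval (fun _ : κ => P) (g i)).map_eq

open Classical in
/-- Replacing the coordinates outside `S` by those of an independent copy preserves powers of a
probability measure. -/
theorem measurePreserving_splice (P : Measure E) [IsProbabilityMeasure P] (S : Set κ) :
    MeasurePreserving
      (fun p : (κ → E) × (κ → E) => fun i => if i ∈ S then p.1 i else p.2 i)
      ((Measure.pi fun _ => P).prod (Measure.pi fun _ => P)) (Measure.pi fun _ => P) := by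
  have h1 : MeasurePreserving (MeasurableEquiv.arrowProdEquivProdArrow E E κ).symm
      ((Measure.pi fun _ => P).prod (Measure.pi fun _ => P))
      (Measure.pi fun _ => P.prod P) :=
    (measurePreserving_arrowProdEquivProdArrow E E κ (fun _ => P) (fun _ => P)).symm
  have h2 : MeasurePreserving
      (fun (q : κ → E × E) i => (fun e : E × E => if i ∈ S then e.1 else e.2) (q i))
      (Measure.pi fun _ => P.prod P) (Measure.pi fun _ => P) := by
    refine measurePreserving_pi (fun _ : κ => P.prod P) (fun _ => P)
      (f := fun i e => if i ∈ S then e.1 else e.2) fun i => ?_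
    by_cases hi : i ∈ S
    · simpa [hi] using (measurePreserving_fst (μ := P) (ν := P))
    · simpa [hi] using (measurePreserving_snd (μ := P) (ν := P))
  exact h2.comp h1

/-- Bounded measurable functions are integrable for a probability measure. -/
theorem integrable_of_bounded {α : Type*} [MeasurableSpace α] {ν : Measure α} [IsFiniteMeasure ν]
    {f : α → ℝ} (hf : Measurable f) {B : ℝ} (hB : ∀ x, |f x| ≤ B) : Integrable f ν :=
  Integrable.of_bound hf.aestronglyMeasurable B (ae_of_all _ fun x => by simpa using hB x)

/-- Two evaluations of a degenerate kernel are orthogonal when they share at most one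
coordinate. -/
theorem integral_mul_eq_zero [DecidableEq ι] (P : Measure E) [IsProbabilityMeasure P]
    {G : (ι → E) → ℝ}
    (hm : Measurable G) {B : ℝ} (hB : ∀ x, |G x| ≤ B)
    (hG : ∀ j z, ∫ x, G (Function.update x j z) ∂(Measure.pi fun _ => P) = 0)
    (f g : ι → κ) (hg : Function.Injective g) (k₀ : ι) (hk : ∀ k ≠ k₀, g k ∉ Set.range f) :
    ∫ z, G (z ∘ f) * G (z ∘ g) ∂(Measure.pi fun _ => P) = 0 := by
  classical
  -- Condition on the coordinates in S and resample the rest. The factor at f is then frozen, while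
  -- the factor at g keeps only its argument k₀ and averages to zero by degeneracy.
  set S : Set κ := insert (g k₀) (Set.range f) with hS
  have hsp := measurePreserving_splice P S
  have hmul : Measurable fun z : κ → E => G (z ∘ f) * G (z ∘ g) := by fun_prop
  have hbd : ∀ z : κ → E, |G (z ∘ f) * G (z ∘ g)| ≤ B * B := fun z => by
    rw [abs_mul]
    exact mul_le_mul (hB _) (hB _) (abs_nonneg _) ((abs_nonneg _).trans (hB (z ∘ f)))
  rw [← hsp.map_eq, integral_map hsp.measurable.aemeasurable hmul.aestronglyMeasurable,
    integral_prod]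
  swap
  · exact integrable_of_bounded (hmul.comp hsp.measurable) fun p => hbd _
  refine integral_eq_zero_of_ae (ae_of_all _ fun z => ?_)
  have key : ∀ z' : κ → E,
      G ((fun i => if i ∈ S then z i else z' i) ∘ f) *
        G ((fun i => if i ∈ S then z i else z' i) ∘ g) =
      G (z ∘ f) * G (Function.update (z' ∘ g) k₀ (z (g k₀))) := fun z' => by
    congr 2
    · funext i
      simp [hS]
    · funext k
      by_cases h : k = k₀
      · subst h; simp [hS]
      · have h1 : g k ≠ g k₀ := fun h' => h (hg h')
        have h2 : g k ∉ S := by simpa [hS, h1] using hk k h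
        simp [h2, h]
  simp only [key, integral_const_mul, Pi.zero_apply]
  -- Injectivity of g is what makes the resampled arguments independent with law P.
  have hmp := measurePreserving_comp_injective P hg
  have := hG k₀ (z (g k₀))
  rw [← hmp.map_eq, integral_map hmp.measurable.aemeasurable] at this
  · rw [this, mul_zero]
  · exact (hm.comp (measurable_update_left)).aestronglyMeasurable

/-! ### Counting index maps with coincidences. -/

/-- The number of maps with two prescribed values. -/
theorem sq_mul_card_filter_eq [DecidableEq ι] [DecidableEq κ] {i j : ι} (hij : i ≠ j) (a b : κ) :
    (Fintype.card κ) ^ 2 * #{g : ι → κ | g i = a ∧ g j = b} =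
      (Fintype.card κ) ^ Fintype.card ι := by
  have h : ({g : ι → κ | g i = a ∧ g j = b} : Finset (ι → κ)) =
      Fintype.piFinset (fun k => if k = i then {a} else if k = j then {b} else univ) := by
    ext g
    simp only [mem_filter, mem_univ, true_and, Fintype.mem_piFinset]
    constructor
    · rintro ⟨rfl, rfl⟩ k
      split_ifs with h1 h2 <;> simp [*]
    · intro h
      exact ⟨by simpa using h i, by simpa [hij.symm] using h j⟩
  rw [h, Fintype.card_piFinset]
  have h3 : ∀ k, #(if k = i then {a} else if k = j then {b} else (univ : Finset κ)) =
      if k = i then 1 else if k = j then 1 else Fintype.card κ := fun k => by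
    split_ifs <;> simp
  simp only [h3]
  rw [← mul_prod_erase univ _ (mem_univ i), if_pos rfl,
    ← mul_prod_erase (univ.erase i) _ (mem_erase.2 ⟨hij.symm, mem_univ j⟩),
    if_neg hij.symm, if_pos rfl, one_mul, one_mul]
  rw [prod_congr rfl (g := fun _ => Fintype.card κ)]
  · rw [prod_const, ← pow_add]
    congr 1
    have h1 : #((univ : Finset ι).erase i) = Fintype.card ι - 1 := by simp
    rw [card_erase_of_mem (mem_erase.2 ⟨hij.symm, mem_univ j⟩), h1]
    have : 2 ≤ Fintype.card ι := by
      have := Finset.card_le_univ ({i, j} : Finset ι)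
      rwa [card_pair hij] at this
    omega
  · intro k hk
    simp only [mem_erase] at hk
    rw [if_neg hk.2.1, if_neg hk.1]

/-- The number of maps with one prescribed coincidence. -/
theorem card_mul_card_filter_eq [DecidableEq ι] [DecidableEq κ] {i j : ι} (hij : i ≠ j) :
    (Fintype.card κ) ^ 2 * #{g : ι → κ | g i = g j} =
      Fintype.card κ * (Fintype.card κ) ^ Fintype.card ι := by
  have h : #{g : ι → κ | g i = g j} = ∑ a : κ, #{g : ι → κ | g i = a ∧ g j = a} := by
    rw [← card_biUnion]
    · congr 1
      ext g
      simp [eq_comm]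
    · intro a _ b _ hab
      refine disjoint_left.2 fun g h1 h2 => hab ?_
      simp only [mem_filter] at h1 h2
      rw [← h1.2.1, ← h2.2.1]
  rw [h, mul_sum]
  simp [sq_mul_card_filter_eq hij]

theorem card_mul_card_filter_le [DecidableEq ι] [DecidableEq κ] {i j : ι} (hij : i ≠ j) :
    Fintype.card κ * #{g : ι → κ | g i = g j} ≤ (Fintype.card κ) ^ Fintype.card ι := by
  rcases Nat.eq_zero_or_pos (Fintype.card κ) with h | h
  · simp [h]
  · refine le_of_eq (Nat.eq_of_mul_eq_mul_left h ?_)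
    rw [← card_mul_card_filter_eq hij]
    ring

/-- The coincidences between two index maps that prevent orthogonality. -/
def Coincides {ι κ : Type*} (f g : ι → κ) (q : ι × ι × ι × ι) : Prop :=
  q.1 ≠ q.2.1 ∧ g q.1 = f q.2.2.1 ∧ g q.2.1 = f q.2.2.2

/-- Both index maps fail to be injective, at the prescribed positions. -/
def BothCollide {ι κ : Type*} (f g : ι → κ) (q : ι × ι × ι × ι) : Prop :=
  (q.1 ≠ q.2.1 ∧ f q.1 = f q.2.1) ∧ (q.2.2.1 ≠ q.2.2.2 ∧ g q.2.2.1 = g q.2.2.2)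

/-- If one map is injective, failure of orthogonality forces two distinct positions of it into the
range of the other. If neither is, each collides with itself. Either way two constraints hold, each
costing a factor 1/N. -/
theorem exists_coincidence {ι κ : Type*} [Nonempty ι] (f g : ι → κ)
    (h1 : ¬(Function.Injective g ∧ ∃ k₀, ∀ k ≠ k₀, g k ∉ Set.range f))
    (h2 : ¬(Function.Injective f ∧ ∃ k₀, ∀ k ≠ k₀, f k ∉ Set.range g)) :
    ∃ q, Coincides f g q ∨ Coincides g f q ∨ BothCollide f g q := by
  have aux : ∀ f g : ι → κ, Function.Injective g →
      ¬(Function.Injective g ∧ ∃ k₀, ∀ k ≠ k₀, g k ∉ Set.range f) →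
      ∃ q, Coincides f g q := by
    intro f g hg h
    push Not at h
    -- The first excluded position is irrelevant. Excluding the position just found then yields a
    -- second, different one.
    obtain ⟨k, -, j, hj⟩ := h hg (Classical.arbitrary ι)
    obtain ⟨k', hk', j', hj'⟩ := h hg k
    exact ⟨(k, k', j, j'), hk'.symm, hj.symm, hj'.symm⟩
  by_cases hg : Function.Injective g
  · obtain ⟨q, hq⟩ := aux f g hg h1
    exact ⟨q, Or.inl hq⟩
  by_cases hf : Function.Injective f
  · obtain ⟨q, hq⟩ := aux g f hf h2
    exact ⟨q, Or.inr (Or.inl hq)⟩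
  · simp only [Function.Injective, not_forall] at hf hg
    obtain ⟨a, b, hab, hne⟩ := hf
    obtain ⟨c, d, hcd, hne'⟩ := hg
    exact ⟨(a, b, c, d), Or.inr (Or.inr ⟨⟨hne, hab⟩, ⟨hne', hcd⟩⟩)⟩

-- For each fixed f, two values of g are prescribed at distinct positions, which leaves a fraction
-- N⁻² of the maps g.
open Classical in
theorem sq_mul_sum_coincides_le [DecidableEq ι] (q : ι × ι × ι × ι) :
    (Fintype.card κ : ℝ) ^ 2 * ∑ f : ι → κ, ∑ g : ι → κ, (if Coincides f g q then (1 : ℝ) else 0) ≤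
      ((Fintype.card κ : ℝ) ^ Fintype.card ι) ^ 2 := by
  by_cases hq : q.1 ≠ q.2.1
  · have h : ∀ f : ι → κ, (Fintype.card κ : ℝ) ^ 2 *
        ∑ g : ι → κ, (if Coincides f g q then (1 : ℝ) else 0) =
        (Fintype.card κ : ℝ) ^ Fintype.card ι := fun f => by
      have := sq_mul_card_filter_eq hq (f q.2.2.1) (f q.2.2.2)
      rw [sum_boole]
      simp only [Coincides, hq, ne_eq, not_false_eq_true, true_and]
      exact_mod_cast this
    rw [mul_sum]
    simp only [h]
    simp [sq]
  · simp only [Coincides, hq, false_and, if_false, sum_const_zero, mul_zero]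
    positivity

-- The constraints on f and on g are separate, so the double sum factors into two counts, each at
-- most a fraction 1/N.
open Classical in
theorem sq_mul_sum_bothCollide_le [DecidableEq ι] (q : ι × ι × ι × ι) :
    (Fintype.card κ : ℝ) ^ 2 *
      ∑ f : ι → κ, ∑ g : ι → κ, (if BothCollide f g q then (1 : ℝ) else 0) ≤
      ((Fintype.card κ : ℝ) ^ Fintype.card ι) ^ 2 := by
  have h : ∀ i j : ι, (Fintype.card κ : ℝ) *
      ∑ f : ι → κ, (if i ≠ j ∧ f i = f j then (1 : ℝ) else 0) ≤
      (Fintype.card κ : ℝ) ^ Fintype.card ι := fun i j => by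
    by_cases hij : i ≠ j
    · rw [sum_boole]
      simp only [hij, ne_eq, not_false_eq_true, true_and]
      exact_mod_cast card_mul_card_filter_le hij
    · simp only [hij, false_and, if_false, sum_const_zero, mul_zero]
      positivity
  have h2 : ∑ f : ι → κ, ∑ g : ι → κ, (if BothCollide f g q then (1 : ℝ) else 0) =
      (∑ f : ι → κ, (if q.1 ≠ q.2.1 ∧ f q.1 = f q.2.1 then (1 : ℝ) else 0)) *
      ∑ g : ι → κ, (if q.2.2.1 ≠ q.2.2.2 ∧ g q.2.2.1 = g q.2.2.2 then (1 : ℝ) else 0) := by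
    rw [sum_mul_sum]
    refine sum_congr rfl fun f _ => sum_congr rfl fun g _ => ?_
    rw [ite_zero_mul_ite_zero, one_mul]
    exact if_congr Iff.rfl rfl rfl
  rw [h2, sq, mul_mul_mul_comm, sq]
  refine mul_le_mul (h _ _) (h _ _) ?_ (by positivity)
  exact mul_nonneg (by positivity) (sum_nonneg fun _ _ => by split_ifs <;> norm_num)

/-! ### Second moment of a degenerate V-statistic. -/

/-- Second moment bound for a V-statistic with a degenerate kernel. -/
theorem sq_mul_integral_sum_sq_le [Nonempty ι] [DecidableEq ι]
    (P : Measure E) [IsProbabilityMeasure P]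
    {G : (ι → E) → ℝ} (hm : Measurable G) {B : ℝ} (hB : ∀ x, |G x| ≤ B)
    (hG : ∀ j z, ∫ x, G (Function.update x j z) ∂(Measure.pi fun _ => P) = 0) :
    (Fintype.card κ : ℝ) ^ 2 *
      ∫ z, (∑ f : ι → κ, G (z ∘ f)) ^ 2 ∂(Measure.pi fun _ : κ => P) ≤
      3 * (Fintype.card ι : ℝ) ^ 4 * B ^ 2 * ((Fintype.card κ : ℝ) ^ Fintype.card ι) ^ 2 := by
  classical
  have hmul : ∀ f g : ι → κ, Measurable fun z : κ → E => G (z ∘ f) * G (z ∘ g) := by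
    intro f g; fun_prop
  have hbd : ∀ (f g : ι → κ) (z : κ → E), |G (z ∘ f) * G (z ∘ g)| ≤ B ^ 2 := fun f g z => by
    rw [abs_mul, sq]
    exact mul_le_mul (hB _) (hB _) (abs_nonneg _) ((abs_nonneg _).trans (hB (z ∘ f)))
  have hint := fun f g => integrable_of_bounded (ν := Measure.pi fun _ : κ => P)
    (hmul f g) (hbd f g)
  -- Union bound: a product expectation is zero or at most B², and in the second case some quadruple
  -- q is counted by D. Three kinds of coincidence and (card ι)⁴ quadruples give the constant 3
  -- (card ι)⁴ B².
  set D : (ι → κ) → (ι → κ) → ι × ι × ι × ι → ℝ := fun f g q =>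
    (if Coincides f g q then (1 : ℝ) else 0) + (if Coincides g f q then (1 : ℝ) else 0) +
      (if BothCollide f g q then (1 : ℝ) else 0) with hD
  have hD0 : ∀ f g q, 0 ≤ D f g q := fun f g q => by
    simp only [hD]; split_ifs <;> norm_num
  have hcov : ∀ f g : ι → κ, ∫ z, G (z ∘ f) * G (z ∘ g) ∂(Measure.pi fun _ : κ => P) ≤
      B ^ 2 * ∑ q, D f g q := fun f g => by
    have hnn : 0 ≤ B ^ 2 * ∑ q, D f g q :=
      mul_nonneg (sq_nonneg _) (sum_nonneg fun q _ => hD0 f g q)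
    by_cases h1 : Function.Injective g ∧ ∃ k₀, ∀ k ≠ k₀, g k ∉ Set.range f
    · obtain ⟨hg, k₀, hk⟩ := h1
      rwa [integral_mul_eq_zero P hm hB hG f g hg k₀ hk]
    by_cases h2 : Function.Injective f ∧ ∃ k₀, ∀ k ≠ k₀, f k ∉ Set.range g
    · obtain ⟨hf, k₀, hk⟩ := h2
      simp_rw [mul_comm (G (_ ∘ f))]
      rwa [integral_mul_eq_zero P hm hB hG g f hf k₀ hk]
    obtain ⟨q, hq⟩ := exists_coincidence f g h1 h2
    have hq1 : 1 ≤ ∑ q, D f g q := by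
      refine le_trans ?_ (single_le_sum (fun q _ => hD0 f g q) (mem_univ q))
      simp only [hD]
      rcases hq with hq | hq | hq <;> simp only [hq, if_true] <;> split_ifs <;> norm_num
    calc ∫ z, G (z ∘ f) * G (z ∘ g) ∂(Measure.pi fun _ : κ => P)
        ≤ ∫ _, B ^ 2 ∂(Measure.pi fun _ : κ => P) :=
          integral_mono (hint f g) (integrable_const _) fun z => (abs_le.1 (hbd f g z)).2
      _ = B ^ 2 := by simp
      _ ≤ _ := le_mul_of_one_le_right (sq_nonneg _) hq1
  have hexp : ∫ z, (∑ f : ι → κ, G (z ∘ f)) ^ 2 ∂(Measure.pi fun _ : κ => P) =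
      ∑ f : ι → κ, ∑ g : ι → κ, ∫ z, G (z ∘ f) * G (z ∘ g) ∂(Measure.pi fun _ : κ => P) := by
    simp_rw [sq, sum_mul_sum]
    rw [integral_finsetSum _ fun f _ => integrable_finsetSum _ fun g _ => hint f g]
    exact sum_congr rfl fun f _ => integral_finsetSum _ fun g _ => hint f g
  have hq : ∀ q, (Fintype.card κ : ℝ) ^ 2 * ∑ f : ι → κ, ∑ g : ι → κ, D f g q ≤
      3 * ((Fintype.card κ : ℝ) ^ Fintype.card ι) ^ 2 := fun q => by
    have a1 := sq_mul_sum_coincides_le (κ := κ) q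
    have a2 := sq_mul_sum_bothCollide_le (κ := κ) q
    have a3 : ∑ f : ι → κ, ∑ g : ι → κ, (if Coincides g f q then (1 : ℝ) else 0) =
      ∑ f : ι → κ, ∑ g : ι → κ, (if Coincides f g q then (1 : ℝ) else 0) := sum_comm
    simp only [hD, sum_add_distrib, mul_add, a3]
    linarith
  rw [hexp]
  calc (Fintype.card κ : ℝ) ^ 2 * ∑ f : ι → κ, ∑ g : ι → κ,
        ∫ z, G (z ∘ f) * G (z ∘ g) ∂(Measure.pi fun _ : κ => P)
      ≤ (Fintype.card κ : ℝ) ^ 2 * ∑ f : ι → κ, ∑ g : ι → κ, B ^ 2 * ∑ q, D f g q :=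
        mul_le_mul_of_nonneg_left
          (sum_le_sum fun f _ => sum_le_sum fun g _ => hcov f g) (by positivity)
    _ = B ^ 2 * ∑ q, (Fintype.card κ : ℝ) ^ 2 * ∑ f : ι → κ, ∑ g : ι → κ, D f g q := by
        simp_rw [← mul_sum]
        rw [mul_left_comm]
        congr 2
        rw [sum_comm]
        refine Eq.trans (sum_congr rfl fun f _ => sum_comm) ?_
        rw [sum_comm]
        exact sum_congr rfl fun q _ => sum_comm
    _ ≤ B ^ 2 * ∑ _q : ι × ι × ι × ι, 3 * ((Fintype.card κ : ℝ) ^ Fintype.card ι) ^ 2 :=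
        mul_le_mul_of_nonneg_left (sum_le_sum fun q _ => hq q) (sq_nonneg _)
    _ = _ := by
        simp only [sum_const, card_univ, Fintype.card_prod, nsmul_eq_mul]
        push_cast
        ring

/-! ### First-order Hoeffding decomposition of a kernel. -/

/-- The first-order projection of a kernel onto its `j`-th argument. -/
noncomputable def proj [DecidableEq ι] (P : Measure E) (H : (ι → E) → ℝ) (j : ι) (z : E) : ℝ :=
  ∫ x, H (Function.update x j z) ∂(Measure.pi fun _ => P) - ∫ x, H x ∂(Measure.pi fun _ => P)

/-- The influence function of a kernel: the sum of its first-order projections. -/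
noncomputable def influence [DecidableEq ι] (P : Measure E) (H : (ι → E) → ℝ) (z : E) : ℝ :=
  ∑ j, proj P H j z

section Projection

variable [DecidableEq ι] (P : Measure E) [IsProbabilityMeasure P] {H : (ι → E) → ℝ}

theorem integral_comp_eq {α β : Type*} [MeasurableSpace α] [MeasurableSpace β] {ν : Measure α}
    {ν' : Measure β} {T : α → β} (hT : MeasurePreserving T ν ν') {φ : β → ℝ} (hφ : Measurable φ) :
    ∫ x, φ (T x) ∂ν = ∫ y, φ y ∂ν' := by
  rw [← hT.map_eq, integral_map hT.measurable.aemeasurable hφ.aestronglyMeasurable]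

theorem measurable_proj (hm : Measurable H) (j : ι) : Measurable (proj P H j) := by
  have : Measurable fun p : E × (ι → E) => H (Function.update p.2 j p.1) := by
    refine hm.comp (measurable_pi_lambda _ fun i => ?_)
    by_cases h : i = j
    · subst h; simpa using measurable_fst
    · simpa [h, Function.comp_def] using (measurable_pi_apply i).comp (measurable_snd (α := E))
  exact (this.stronglyMeasurable.integral_prod_right').measurable.sub_const _

theorem measurable_influence (hm : Measurable H) : Measurable (influence P H) :=
  measurable_fun_sum _ fun j _ => measurable_proj P hm j

theorem abs_integral_le_of_bounded {α : Type*} [MeasurableSpace α] {ν : Measure α}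
    [IsProbabilityMeasure ν] {f : α → ℝ} {B : ℝ} (hB : ∀ x, |f x| ≤ B) : |∫ x, f x ∂ν| ≤ B := by
  simpa using norm_integral_le_of_norm_le_const (μ := ν) (f := f) (ae_of_all _ hB)

theorem abs_proj_le {B : ℝ} (hB : ∀ x, |H x| ≤ B) (j : ι) (z : E) : |proj P H j z| ≤ 2 * B := by
  refine (abs_sub _ _).trans ?_
  have h1 := abs_integral_le_of_bounded (ν := Measure.pi fun _ : ι => P)
    (f := fun x => H (Function.update x j z)) (fun x => hB _)
  have h2 := abs_integral_le_of_bounded (ν := Measure.pi fun _ : ι => P) hB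
  linarith

theorem abs_influence_le {B : ℝ} (hB : ∀ x, |H x| ≤ B) (z : E) :
    |influence P H z| ≤ Fintype.card ι * (2 * B) := by
  refine (abs_sum_le_sum_abs _ _).trans ((sum_le_sum fun j _ => abs_proj_le P hB j z).trans ?_)
  simp

/-- Resampling coordinate j from an independent copy leaves the product law unchanged, so averaging
over the fixed argument recovers the mean of H. -/
theorem integral_proj (hm : Measurable H) {B : ℝ} (hB : ∀ x, |H x| ≤ B) (j : ι) :
    ∫ z, proj P H j z ∂P = 0 := by
  have hev := measurePreserving_eval (fun _ : ι => P) j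
  have hsp := measurePreserving_splice P ({j}ᶜ : Set ι)
  -- The variable z is realised as coordinate j of a full independent sample, so that the splicing
  -- map applies.
  refine (integral_comp_eq hev (measurable_proj P hm j)).symm.trans ?_
  have hint : Integrable
      (fun y : ι → E => ∫ x, H (Function.update x j (y j)) ∂(Measure.pi fun _ : ι => P))
      (Measure.pi fun _ : ι => P) := by
    have := integrable_of_bounded (ν := Measure.pi fun _ : ι => P)
      (((measurable_proj P hm j).add_const (∫ x, H x ∂(Measure.pi fun _ => P))).comp hev.measurable)
      (B := B) (fun y => by
        simpa [proj] using abs_integral_le_of_bounded (ν := Measure.pi fun _ : ι => P)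
          (f := fun x => H (Function.update x j (y j))) (fun x => hB _))
    simpa [proj, Function.comp_def] using this
  simp only [proj, Function.eval]
  rw [integral_sub hint (integrable_const _)]
  have key : ∀ x y : ι → E, Function.update x j (y j) =
      fun i => if i ∈ ({j}ᶜ : Set ι) then x i else y i := fun x y => by
    funext i
    by_cases h : i = j
    · subst h; simp
    · simp [h]
  have h2 : ∫ x, H x ∂(Measure.pi fun _ : ι => P) =
      ∫ y, ∫ x, H (Function.update x j (y j)) ∂(Measure.pi fun _ : ι => P)
        ∂(Measure.pi fun _ : ι => P) := by
    conv_lhs => rw [← hsp.map_eq]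
    rw [integral_map hsp.measurable.aemeasurable hm.aestronglyMeasurable, integral_prod_symm]
    · simp only [key]
    · exact integrable_of_bounded (hm.comp hsp.measurable) fun p => hB _
  simp [h2]

theorem integral_influence (hm : Measurable H) {B : ℝ} (hB : ∀ x, |H x| ≤ B) :
    ∫ z, influence P H z ∂P = 0 := by
  unfold influence
  rw [integral_finsetSum]
  · exact sum_eq_zero fun j _ => integral_proj P hm hB j
  · exact fun j _ => integrable_of_bounded (measurable_proj P hm j) (abs_proj_le P hB j)

/-- The kernel minus its mean and first-order projections. -/
noncomputable def degenerate (H : (ι → E) → ℝ) (x : ι → E) : ℝ :=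
  H x - ∫ x, H x ∂(Measure.pi fun _ => P) - ∑ j, proj P H j (x j)

theorem measurable_degenerate (hm : Measurable H) : Measurable (degenerate P H) := by
  have := fun j => measurable_proj P hm j
  unfold degenerate
  fun_prop

theorem abs_degenerate_le {B : ℝ} (hB : ∀ x, |H x| ≤ B) (x : ι → E) :
    |degenerate P H x| ≤ B + B + Fintype.card ι * (2 * B) := by
  refine (abs_sub _ _).trans (add_le_add ((abs_sub _ _).trans (add_le_add (hB x) ?_)) ?_)
  · exact abs_integral_le_of_bounded hB
  · refine (abs_sum_le_sum_abs _ _).trans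
      ((sum_le_sum fun j _ => abs_proj_le P hB j (x j)).trans ?_)
    simp

/-- Fixing argument j at z, the centred kernel averages to its j-th projection at z, which is
subtracted. The other projections average to zero. -/
theorem integral_degenerate_update (hm : Measurable H) {B : ℝ} (hB : ∀ x, |H x| ≤ B) (j : ι)
    (z : E) :
    ∫ x, degenerate P H (Function.update x j z) ∂(Measure.pi fun _ => P) = 0 := by
  have hup : Measurable fun x : ι → E => Function.update x j z := measurable_update_left
  have hp : ∀ i, Integrable (fun x : ι → E => proj P H i (Function.update x j z i))
      (Measure.pi fun _ => P) := fun i =>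
    integrable_of_bounded ((measurable_proj P hm i).comp ((measurable_pi_apply i).comp hup))
      fun x => abs_proj_le P hB i _
  have hH : Integrable (fun x : ι → E => H (Function.update x j z)) (Measure.pi fun _ => P) :=
    integrable_of_bounded (hm.comp hup) fun x => hB _
  have hH' : Integrable (fun x : ι → E => H (Function.update x j z) -
      ∫ x, H x ∂(Measure.pi fun _ => P)) (Measure.pi fun _ => P) := hH.sub (integrable_const _)
  unfold degenerate
  rw [integral_sub hH' (integrable_finsetSum _ fun i _ => hp i),
    integral_sub hH (integrable_const _), integral_finsetSum _ fun i _ => hp i,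
    ← add_sum_erase univ _ (mem_univ j), sum_eq_zero]
  · simp [proj]
  · intro i hi
    have hij : i ≠ j := (mem_erase.1 hi).1
    have hev := measurePreserving_eval (fun _ : ι => P) i
    simp only [Function.update_of_ne hij]
    exact (integral_comp_eq hev (measurable_proj P hm i)).trans
      (integral_proj P hm hB i)

end Projection

/-! ### V-statistics and their linearisation. -/

/-- Summing over all maps a function of a single value. -/
theorem card_mul_sum_apply [DecidableEq ι] (φ : κ → ℝ) (j : ι) :
    (Fintype.card κ : ℝ) * ∑ f : ι → κ, φ (f j) =
      (Fintype.card κ : ℝ) ^ Fintype.card ι * ∑ n, φ n := by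
  classical
  -- View φ (f j) as a product over all positions, with factor 1 away from j, and expand the product
  -- of sums.
  have h := (prod_univ_sum (fun _ : ι => (univ : Finset κ))
    (fun i n => if i = j then φ n else (1 : ℝ)))
  simp only [Fintype.piFinset_univ] at h
  have h2 : ∀ f : ι → κ, ∏ i, (if i = j then φ (f i) else (1 : ℝ)) = φ (f j) := fun f => by
    simp
  simp only [h2] at h
  rw [← h, ← mul_prod_erase univ _ (mem_univ j), prod_congr rfl
    (g := fun _ => (Fintype.card κ : ℝ)) (fun i hi => by simp [(mem_erase.1 hi).1]),
    prod_const, card_erase_of_mem (mem_univ j), card_univ]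
  have : (Fintype.card κ : ℝ) ^ Fintype.card ι =
      Fintype.card κ * (Fintype.card κ : ℝ) ^ (Fintype.card ι - 1) := by
    rw [← pow_succ', Nat.sub_add_cancel (Fintype.card_pos_iff.2 ⟨j⟩)]
  rw [this]
  simp only [if_true]
  ring

/-- The V-statistic with kernel `H` evaluated at the sample `z`. -/
noncomputable def vStat [DecidableEq ι] (H : (ι → E) → ℝ) (z : κ → E) : ℝ :=
  (∑ f : ι → κ, H (z ∘ f)) / (Fintype.card κ : ℝ) ^ Fintype.card ι

/-- The V-statistic of a function of one argument is its sample mean, so subtracting the projections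
from the kernel subtracts the average influence. -/
theorem vStat_sub_eq [DecidableEq ι] [Nonempty κ] (P : Measure E)
    (H : (ι → E) → ℝ) (z : κ → E) :
    vStat H z - ∫ x, H x ∂(Measure.pi fun _ => P) -
        (∑ n, influence P H (z n)) / Fintype.card κ =
      (∑ f : ι → κ, degenerate P H (z ∘ f)) / (Fintype.card κ : ℝ) ^ Fintype.card ι := by
  have hN : (Fintype.card κ : ℝ) ≠ 0 := by simp
  have h1 : (∑ n, influence P H (z n)) / Fintype.card κ =
      (∑ f : ι → κ, ∑ j, proj P H j (z (f j))) / (Fintype.card κ : ℝ) ^ Fintype.card ι := by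
    rw [div_eq_div_iff hN (pow_ne_zero _ hN), sum_comm, sum_mul, sum_mul]
    unfold influence
    simp only [sum_mul]
    rw [sum_comm]
    refine sum_congr rfl fun j _ => ?_
    have := card_mul_sum_apply (ι := ι) (fun n => proj P H j (z n)) j
    rw [← sum_mul, ← sum_mul]
    linarith
  rw [h1]
  simp only [degenerate, sum_sub_distrib, vStat, sub_div, Function.comp_apply, sum_const, card_univ,
    Fintype.card_fun, nsmul_eq_mul]
  push_cast
  rw [mul_div_cancel_left₀ _ (pow_ne_zero _ hN)]

/-- A V-statistic with a bounded kernel is asymptotically linear in mean square, at rate `N⁻²`. -/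
theorem exists_integral_vStat_sub_sq_le [Nonempty ι] [DecidableEq ι] (P : Measure E)
    [IsProbabilityMeasure P] {H : (ι → E) → ℝ} (hm : Measurable H) {B : ℝ}
    (hB : ∀ x, |H x| ≤ B) :
    ∃ C, ∀ N : ℕ, 0 < N → ∫ z, (vStat H z - ∫ x, H x ∂(Measure.pi fun _ => P) -
        (∑ n, influence P H (z n)) / N) ^ 2 ∂(Measure.pi fun _ : Fin N => P) ≤ C / (N : ℝ) ^ 2 := by
  refine ⟨3 * (Fintype.card ι : ℝ) ^ 4 * (B + B + Fintype.card ι * (2 * B)) ^ 2, fun N hN => ?_⟩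
  have : Nonempty (Fin N) := ⟨⟨0, hN⟩⟩
  have h := sq_mul_integral_sum_sq_le (κ := Fin N) P (measurable_degenerate P hm)
    (abs_degenerate_le P hB) (integral_degenerate_update P hm hB)
  have h2 : ∀ z : Fin N → E, vStat H z - ∫ x, H x ∂(Measure.pi fun _ => P) -
        (∑ n, influence P H (z n)) / N =
      (∑ f : ι → Fin N, degenerate P H (z ∘ f)) / (N : ℝ) ^ Fintype.card ι := fun z => by
    have := vStat_sub_eq P H z
    rwa [Fintype.card_fin] at this
  simp only [h2, div_pow]
  rw [Fintype.card_fin] at h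
  have hN' : (0 : ℝ) < N := by exact_mod_cast hN
  rw [integral_div, div_le_div_iff₀ (by positivity) (by positivity)]
  linarith

end VStatistic

/-! ### Asymptotic linearity in mean square, limiting variance and normality. -/

namespace VStatistic

open Finset

variable {Ω E : Type*} [MeasurableSpace Ω] [MeasurableSpace E]

theorem eLpNorm_two_eq_ofReal_sqrt {μ : Measure Ω} {f : Ω → ℝ} (hf : MemLp f 2 μ) :
    eLpNorm f 2 μ = ENNReal.ofReal (√(∫ ω, f ω ^ 2 ∂μ)) := by
  rw [hf.eLpNorm_eq_integral_rpow_norm (by norm_num) (by norm_num), Real.sqrt_eq_rpow]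
  simp

/-- The quadratic t ↦ Var(S + tR) is nonnegative, so its discriminant is not positive. -/
theorem covariance_sq_le {μ : Measure Ω} [IsProbabilityMeasure μ] {S R : Ω → ℝ}
    (hS : MemLp S 2 μ) (hR : MemLp R 2 μ) :
    covariance S R μ ^ 2 ≤ variance S μ * variance R μ := by
  have h : ∀ t : ℝ, 0 ≤ variance R μ * (t * t) + 2 * covariance S R μ * t + variance S μ :=
    fun t => by
      have h1 := variance_add hS (hR.const_smul t)
      rw [covariance_smul_right, variance_smul] at h1
      have h2 := variance_nonneg (S + t • R) μ
      linarith
  have := discrim_le_zero h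
  unfold discrim at this
  linarith

/-- Adding a sequence that vanishes in mean square does not change the limiting variance. -/
theorem tendsto_variance_add {μ : Measure Ω} [IsProbabilityMeasure μ] {S R : ℕ → Ω → ℝ}
    (hS : ∀ N, MemLp (S N) 2 μ) (hR : ∀ N, MemLp (R N) 2 μ) {v : ℝ}
    (hv : Tendsto (fun N => variance (S N) μ) atTop (𝓝 v))
    (h0 : Tendsto (fun N => eLpNorm (R N) 2 μ) atTop (𝓝 0)) :
    Tendsto (fun N => variance (S N + R N) μ) atTop (𝓝 v) := by
  have hint : Tendsto (fun N => ∫ ω, R N ω ^ 2 ∂μ) atTop (𝓝 0) := by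
    have h1 : Tendsto (fun N => (eLpNorm (R N) 2 μ).toReal ^ 2) atTop (𝓝 0) := by
      simpa using ((ENNReal.tendsto_toReal ENNReal.zero_ne_top).comp h0).pow 2
    refine h1.congr fun N => ?_
    rw [eLpNorm_two_eq_ofReal_sqrt (hR N), ENNReal.toReal_ofReal (Real.sqrt_nonneg _),
      Real.sq_sqrt (integral_nonneg fun _ => sq_nonneg _)]
  have hvar : Tendsto (fun N => variance (R N) μ) atTop (𝓝 0) :=
    squeeze_zero (fun N => variance_nonneg _ _)
      (fun N => variance_le_expectation_sq (hR N).aestronglyMeasurable) hint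
  have hcov : Tendsto (fun N => covariance (S N) (R N) μ) atTop (𝓝 0) := by
    have h1 : Tendsto (fun N => √(variance (S N) μ * variance (R N) μ)) atTop (𝓝 0) := by
      have := (Real.continuous_sqrt.tendsto _).comp (hv.mul hvar)
      simpa [Function.comp_def] using this
    exact squeeze_zero_norm (fun N => Real.abs_le_sqrt (covariance_sq_le (hS N) (hR N))) h1
  have := (hv.add (hcov.const_mul 2)).add hvar
  simp only [mul_zero, add_zero] at this
  exact this.congr fun N => (variance_add (hS N) (hR N)).symm

/-- The normalised sum of an influence function over the first `N` observations. -/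
noncomputable def normSum (Z : ℕ → Ω → E) (ψ : E → ℝ) (N : ℕ) (ω : Ω) : ℝ :=
  (√N)⁻¹ * ∑ n ∈ range N, ψ (Z n ω)

/-- The sequence of statistics `T` estimates `c` with influence function `ψ`, with an error that is
negligible in mean square. -/
structure IsAsympLinear (μ : Measure Ω) (Z : ℕ → Ω → E) (T : ℕ → Ω → ℝ) (c : ℝ) (ψ : E → ℝ) :
    Prop where
  measurable : ∀ N, Measurable (T N)
  memLp : ∀ N, MemLp (T N) 2 μ
  measurable_influence : Measurable ψ
  bounded_influence : ∃ B, ∀ z, |ψ z| ≤ B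
  integral_influence : ∫ ω, ψ (Z 0 ω) ∂μ = 0
  tendsto : Tendsto (fun N : ℕ => eLpNorm (fun ω => √N * (T N ω - c) - normSum Z ψ N ω) 2 μ)
    atTop (𝓝 0)

theorem memLp_two_of_bounded {α : Type*} [MeasurableSpace α] {ν : Measure α} [IsFiniteMeasure ν]
    {f : α → ℝ} (hf : Measurable f) {B : ℝ} (hB : ∀ x, |f x| ≤ B) : MemLp f 2 ν :=
  MemLp.of_bound hf.aestronglyMeasurable B (ae_of_all _ hB)

namespace IsAsympLinear

variable {μ : Measure Ω} [IsProbabilityMeasure μ] {Z : ℕ → Ω → E} {T T' : ℕ → Ω → ℝ} {c c' : ℝ}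
  {ψ ψ' : E → ℝ}

theorem memLp_influence (hZ : ∀ n, Measurable (Z n)) (h : IsAsympLinear μ Z T c ψ) (n : ℕ) :
    MemLp (fun ω => ψ (Z n ω)) 2 μ := by
  obtain ⟨B, hB⟩ := h.bounded_influence
  exact memLp_two_of_bounded (h.measurable_influence.comp (hZ n)) fun ω => hB _

theorem memLp_normSum (hZ : ∀ n, Measurable (Z n)) (h : IsAsympLinear μ Z T c ψ) (N : ℕ) :
    MemLp (normSum Z ψ N) 2 μ :=
  (memLp_finsetSum _ fun n _ => h.memLp_influence hZ n).const_mul _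

theorem memLp_error (hZ : ∀ n, Measurable (Z n)) (h : IsAsympLinear μ Z T c ψ) (N : ℕ) :
    MemLp (fun ω => √N * (T N ω - c) - normSum Z ψ N ω) 2 μ :=
  (((h.memLp N).sub (memLp_const c)).const_mul _).sub (h.memLp_normSum hZ N)

theorem zero : IsAsympLinear μ Z (fun _ _ => 0) 0 (fun _ => 0) where
  measurable _ := measurable_const
  memLp _ := memLp_const 0
  measurable_influence := measurable_const
  bounded_influence := ⟨0, by simp⟩
  integral_influence := by simp
  tendsto := by simp [normSum]

theorem add (hZ : ∀ n, Measurable (Z n)) (h : IsAsympLinear μ Z T c ψ)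
    (h' : IsAsympLinear μ Z T' c' ψ') :
    IsAsympLinear μ Z (fun N ω => T N ω + T' N ω) (c + c') (fun z => ψ z + ψ' z) where
  measurable N := (h.measurable N).add (h'.measurable N)
  memLp N := (h.memLp N).add (h'.memLp N)
  measurable_influence := h.measurable_influence.add h'.measurable_influence
  bounded_influence := by
    obtain ⟨B, hB⟩ := h.bounded_influence
    obtain ⟨B', hB'⟩ := h'.bounded_influence
    exact ⟨B + B', fun z => (abs_add_le _ _).trans (add_le_add (hB z) (hB' z))⟩
  integral_influence := by
    rw [integral_add ((h.memLp_influence hZ 0).integrable (by norm_num))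
      ((h'.memLp_influence hZ 0).integrable (by norm_num)), h.integral_influence,
      h'.integral_influence, add_zero]
  tendsto := by
    have h0 := h.tendsto.add h'.tendsto
    rw [add_zero] at h0
    refine tendsto_of_tendsto_of_tendsto_of_le_of_le tendsto_const_nhds h0 (fun _ => zero_le)
      fun N => ?_
    refine le_trans (le_of_eq ?_) (eLpNorm_add_le (h.memLp_error hZ N).aestronglyMeasurable
      (h'.memLp_error hZ N).aestronglyMeasurable (by norm_num))
    congr 1
    funext ω
    simp only [normSum, sum_add_distrib, Pi.add_apply]
    ring

theorem const_mul {μ : Measure Ω} (h : IsAsympLinear μ Z T c ψ) (a : ℝ) :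
    IsAsympLinear μ Z (fun N ω => a * T N ω) (a * c) (fun z => a * ψ z) where
  measurable N := (h.measurable N).const_mul a
  memLp N := (h.memLp N).const_mul a
  measurable_influence := h.measurable_influence.const_mul a
  bounded_influence := by
    obtain ⟨B, hB⟩ := h.bounded_influence
    exact ⟨|a| * B, fun z => by
      rw [abs_mul]; exact mul_le_mul_of_nonneg_left (hB z) (abs_nonneg a)⟩
  integral_influence := by rw [integral_const_mul, h.integral_influence, mul_zero]
  tendsto := by
    have h0 := ENNReal.Tendsto.const_mul (a := ‖a‖ₑ) h.tendsto (Or.inr enorm_ne_top)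
    rw [mul_zero] at h0
    refine h0.congr fun N => ?_
    rw [← eLpNorm_const_smul]
    congr 1
    funext ω
    simp only [normSum, ← mul_sum, Pi.smul_apply, smul_eq_mul]
    ring

theorem sum (hZ : ∀ n, Measurable (Z n)) {α : Type*} (s : Finset α) {T : α → ℕ → Ω → ℝ}
    {c : α → ℝ} {ψ : α → E → ℝ} (h : ∀ i ∈ s, IsAsympLinear μ Z (T i) (c i) (ψ i)) :
    IsAsympLinear μ Z (fun N ω => ∑ i ∈ s, T i N ω) (∑ i ∈ s, c i) (fun z => ∑ i ∈ s, ψ i z) := by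
  classical
  induction s using Finset.induction_on with
  | empty => simpa using zero
  | insert i s hi ih =>
    simp only [sum_insert hi]
    exact (h i (mem_insert_self i s)).add hZ (ih fun j hj => h j (mem_insert_of_mem hj))

/-- Bounded statistics that eventually agree up to a factor `1 + o(N^(-1/2))` share their influence
function. -/
theorem of_eventually_eq_mul (hZ : ∀ n, Measurable (Z n)) (h : IsAsympLinear μ Z T c ψ) {B : ℝ}
    (hB : ∀ N ω, |T N ω| ≤ B) {r : ℕ → ℝ} (hr : Tendsto (fun N : ℕ => √N * (r N - 1)) atTop (𝓝 0))
    (hm : ∀ N, Measurable (T' N)) (hL : ∀ N, MemLp (T' N) 2 μ)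
    (hT' : ∀ᶠ N in atTop, ∀ ω, T' N ω = r N * T N ω) : IsAsympLinear μ Z T' c ψ where
  measurable := hm
  memLp := hL
  measurable_influence := h.measurable_influence
  bounded_influence := h.bounded_influence
  integral_influence := h.integral_influence
  tendsto := by
    have hr' : Tendsto (fun N : ℕ => ENNReal.ofReal (|√N * (r N - 1)| * B)) atTop (𝓝 0) := by
      have := ENNReal.tendsto_ofReal (hr.abs.mul_const B)
      simpa using this
    have h0 := h.tendsto.add hr'
    rw [add_zero] at h0
    refine tendsto_of_tendsto_of_tendsto_of_le_of_le' tendsto_const_nhds h0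
      (Eventually.of_forall fun _ => zero_le) ?_
    filter_upwards [hT'] with N hN
    -- The extra error is √N (r N - 1) T N, which vanishes uniformly because T is bounded.
    have heq : (fun ω => √N * (T' N ω - c) - normSum Z ψ N ω) =
        (fun ω => √N * (T N ω - c) - normSum Z ψ N ω) + fun ω => √N * (r N - 1) * T N ω := by
      funext ω
      simp only [hN, Pi.add_apply]
      ring
    rw [heq]
    refine (eLpNorm_add_le (h.memLp_error hZ N).aestronglyMeasurable
      ((h.memLp N).const_mul _).aestronglyMeasurable (by norm_num)).trans ?_
    gcongr
    refine (eLpNorm_le_of_ae_bound (C := |√N * (r N - 1)| * B) (ae_of_all _ fun ω => ?_)).trans ?_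
    · rw [norm_mul]
      exact mul_le_mul_of_nonneg_left (hB N ω) (abs_nonneg _)
    · simp

/-- The variance of an asymptotically linear sequence of statistics of an i.i.d. sample, scaled by
the sample size, converges to the variance of the influence function. -/
theorem tendsto_variance (hZ : ∀ n, Measurable (Z n)) (h : IsAsympLinear μ Z T c ψ)
    (hindep : iIndepFun Z μ) (hident : ∀ n, IdentDistrib (Z n) (Z 0) μ μ) :
    Tendsto (fun N : ℕ => (N : ℝ) * variance (T N) μ) atTop
      (𝓝 (variance (fun ω => ψ (Z 0 ω)) μ)) := by
  have hS : Tendsto (fun N : ℕ => variance (normSum Z ψ N) μ) atTop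
      (𝓝 (variance (fun ω => ψ (Z 0 ω)) μ)) := by
    -- For N > 0 the normalised sum has exactly the variance of one summand. N = 0 is excluded since
    -- the sum is then zero.
    refine tendsto_const_nhds.congr' ?_
    filter_upwards [eventually_gt_atTop 0] with N hN
    have hN' : (N : ℝ) ≠ 0 := by exact_mod_cast hN.ne'
    have h1 : variance (∑ n ∈ range N, fun ω => ψ (Z n ω)) μ =
        ∑ n ∈ range N, variance (fun ω => ψ (Z n ω)) μ :=
      IndepFun.variance_sum (fun n _ => h.memLp_influence hZ n) fun i _ j _ hij =>
        (hindep.indepFun hij).comp h.measurable_influence h.measurable_influence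
    have h2 : ∀ n, variance (fun ω => ψ (Z n ω)) μ = variance (fun ω => ψ (Z 0 ω)) μ := fun n =>
      ((hident n).comp h.measurable_influence).variance_eq
    have h3 : normSum Z ψ N = fun ω => (√N)⁻¹ * (∑ n ∈ range N, fun ω => ψ (Z n ω)) ω := by
      funext ω
      simp [normSum]
    rw [h3, variance_const_mul, h1]
    simp only [h2, sum_const, card_range, nsmul_eq_mul]
    rw [inv_pow, Real.sq_sqrt (Nat.cast_nonneg N), inv_mul_cancel_left₀ hN']
  refine (tendsto_variance_add (h.memLp_normSum hZ) (h.memLp_error hZ) hS h.tendsto).congr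
    fun N => ?_
  have h1 : (normSum Z ψ N + fun ω => √N * (T N ω - c) - normSum Z ψ N ω) =
      fun ω => √N * (T N ω - c) := by
    funext ω
    simp
  rw [h1, variance_const_mul, variance_sub_const (h.measurable N).aestronglyMeasurable,
    Real.sq_sqrt (Nat.cast_nonneg N)]

/-- An asymptotically linear sequence of statistics of an i.i.d. sample is asymptotically normal. -/
theorem tendstoInDistribution (hZ : ∀ n, Measurable (Z n)) (h : IsAsympLinear μ Z T c ψ)
    (hindep : iIndepFun Z μ) (hident : ∀ n, IdentDistrib (Z n) (Z 0) μ μ) :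
    TendstoInDistribution (fun (N : ℕ) ω => √N * (T N ω - c)) atTop (id : ℝ → ℝ) (fun _ => μ)
      (gaussianReal 0 (variance (fun ω => ψ (Z 0 ω)) μ).toNNReal) := by
  have hclt := tendstoInDistribution_inv_sqrt_mul_sum_sub (P := μ)
    (X := fun n ω => ψ (Z n ω))
    (HasLaw.id (μ := gaussianReal 0 (variance (fun ω => ψ (Z 0 ω)) μ).toNNReal))
    (h.memLp_influence hZ 0) (hindep.comp (fun _ => ψ) fun _ => h.measurable_influence)
    fun n => (hident n).comp h.measurable_influence
  simp only [h.integral_influence, mul_zero, sub_zero] at hclt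
  -- Slutsky: the L² error also vanishes in measure.
  refine tendstoInDistribution_of_tendstoInMeasure_sub _ _ hclt ?_ fun N => ?_
  · refine tendstoInMeasure_of_tendsto_eLpNorm (p := 2) (by norm_num) (fun N => ?_)
      aestronglyMeasurable_const ?_
    · exact (h.memLp_error hZ N).aestronglyMeasurable
    · refine h.tendsto.congr fun N => ?_
      congr 1
      funext ω
      simp [normSum]
  · exact (((h.measurable N).sub_const c).const_mul _).aemeasurable

end IsAsympLinear

/-! ### Asymptotic linearity of V-statistics with bounded kernels. -/

section Statistic

variable {ι : Type*} [Fintype ι] [DecidableEq ι] {κ : Type*} [Fintype κ]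

theorem abs_vStat_le {E : Type*} {H : (ι → E) → ℝ} {B : ℝ} (hB : ∀ x, |H x| ≤ B) (hB0 : 0 ≤ B)
    (z : κ → E) : |vStat H z| ≤ B := by
  unfold vStat
  rw [abs_div, abs_of_nonneg (by positivity : (0 : ℝ) ≤ (Fintype.card κ : ℝ) ^ Fintype.card ι)]
  refine div_le_of_le_mul₀ (by positivity) hB0 ((abs_sum_le_sum_abs _ _).trans
    ((sum_le_sum fun f _ => hB _).trans ?_))
  simp [mul_comm]

theorem measurable_vStat {H : (ι → E) → ℝ} (hm : Measurable H) :
    Measurable (fun z : κ → E => vStat H z) := by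
  unfold vStat
  fun_prop

/-- V-statistics of an i.i.d. sample with a bounded kernel are asymptotically linear. -/
theorem isAsympLinear_vStat [Nonempty ι] {μ : Measure Ω} [IsProbabilityMeasure μ]
    {Z : ℕ → Ω → E} (hZ : ∀ n, Measurable (Z n)) (hindep : iIndepFun Z μ)
    (hident : ∀ n, IdentDistrib (Z n) (Z 0) μ μ) {H : (ι → E) → ℝ} (hm : Measurable H) {B : ℝ}
    (hB : ∀ x, |H x| ≤ B) :
    IsAsympLinear μ Z (fun N ω => vStat H fun n : Fin N => Z n ω)
      (∫ x, H x ∂(Measure.pi fun _ => μ.map (Z 0))) (influence (μ.map (Z 0)) H) := by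
  set P := μ.map (Z 0) with hP
  have : IsProbabilityMeasure P := Measure.isProbabilityMeasure_map (hZ 0).aemeasurable
  obtain ⟨ω₀⟩ : Nonempty Ω := μ.nonempty_of_neZero
  have hB0 : 0 ≤ B := (abs_nonneg _).trans (hB fun _ => Z 0 ω₀)
  have hsample : ∀ N : ℕ, Measurable fun ω => fun n : Fin N => Z n ω := fun N => by fun_prop
  have hmeas : ∀ N : ℕ, Measurable fun ω => vStat H fun n : Fin N => Z n ω := fun N =>
    (measurable_vStat hm).comp (hsample N)
  have hψ := measurable_influence P hm
  refine ⟨hmeas, fun N => memLp_two_of_bounded (hmeas N) fun ω => abs_vStat_le hB hB0 _, hψ,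
    ⟨_, abs_influence_le P hB⟩, ?_, ?_⟩
  · rw [← integral_influence P hm hB, hP,
      integral_map (hZ 0).aemeasurable hψ.aestronglyMeasurable]
  obtain ⟨C, hC⟩ := exists_integral_vStat_sub_sq_le P hm hB
  have hlaw : ∀ N : ℕ, MeasurePreserving (fun ω => fun n : Fin N => Z n ω) μ
      (Measure.pi fun _ => P) := fun N => by
    refine ⟨hsample N, ?_⟩
    have h := (iIndepFun_iff_map_fun_eq_pi_map (fun n : Fin N => (hZ n).aemeasurable)).1
      (hindep.precomp Fin.val_injective)
    refine h.trans ?_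
    congr 1
    funext n
    exact (hident n).map_eq
  -- The scaling √N multiplies the mean-square error C / N² by N, leaving C / N under the root.
  have hbound : ∀ N : ℕ, 0 < N → eLpNorm (fun ω => √N * ((vStat H fun n : Fin N => Z n ω) -
      ∫ x, H x ∂(Measure.pi fun _ => P)) - normSum Z (influence P H) N ω) 2 μ ≤
      ENNReal.ofReal √(C / N) := fun N hN => by
    have hN' : (0 : ℝ) < N := by exact_mod_cast hN
    have hs : √(N : ℝ) ≠ 0 := (Real.sqrt_pos.2 hN').ne'
    set φ : (Fin N → E) → ℝ := fun z => (vStat H z - ∫ x, H x ∂(Measure.pi fun _ => P) -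
        (∑ n, influence P H (z n)) / N) ^ 2 with hφ
    have hφm : Measurable φ := by
      have := measurable_vStat (κ := Fin N) hm
      simp only [hφ]
      fun_prop
    have heq : (fun ω => √N * ((vStat H fun n : Fin N => Z n ω) -
        ∫ x, H x ∂(Measure.pi fun _ => P)) - normSum Z (influence P H) N ω) =
        fun ω => √N * ((vStat H fun n : Fin N => Z n ω) -
        ∫ x, H x ∂(Measure.pi fun _ => P) - (∑ n : Fin N, influence P H (Z n ω)) / N) := by
      funext ω
      rw [normSum, ← Fin.sum_univ_eq_sum_range (fun n => influence P H (Z n ω)), mul_sub √(N : ℝ)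
        (_ - _)]
      congr 1
      have : (N : ℝ) = √N * √N := (Real.mul_self_sqrt hN'.le).symm
      rw [mul_div_assoc']
      conv_rhs => rw [this]
      rw [Real.sqrt_mul_self (Real.sqrt_nonneg _)]
      field_simp
    have hbd : ∀ z : Fin N → E, |vStat H z - ∫ x, H x ∂(Measure.pi fun _ => P) -
        (∑ n, influence P H (z n)) / N| ≤
        B + |∫ x, H x ∂(Measure.pi fun _ => P)| +
          (∑ _n : Fin N, Fintype.card ι * (2 * B)) / N := fun z => by
      refine (abs_sub _ _).trans (add_le_add ((abs_sub _ _).trans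
        (add_le_add (abs_vStat_le hB hB0 z) le_rfl)) ?_)
      rw [abs_div, abs_of_pos hN']
      gcongr
      exact (abs_sum_le_sum_abs _ _).trans (sum_le_sum fun n _ => abs_influence_le P hB _)
    have hL : MemLp (fun ω => (vStat H fun n : Fin N => Z n ω) -
        ∫ x, H x ∂(Measure.pi fun _ => P) - (∑ n : Fin N, influence P H (Z n ω)) / N) 2 μ := by
      refine memLp_two_of_bounded ?_ fun ω => hbd fun n : Fin N => Z n ω
      have := hmeas N
      fun_prop
    rw [heq, eLpNorm_two_eq_ofReal_sqrt (hL.const_mul _)]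
    refine ENNReal.ofReal_le_ofReal (Real.sqrt_le_sqrt ?_)
    simp only [mul_pow, Real.sq_sqrt hN'.le]
    rw [integral_const_mul]
    have h1 : ∫ ω, φ (fun n : Fin N => Z n ω) ∂μ = ∫ z, φ z ∂(Measure.pi fun _ => P) :=
      integral_comp_eq (hlaw N) hφm
    simp only [hφ] at h1
    rw [h1]
    refine (mul_le_mul_of_nonneg_left (hC N hN) hN'.le).trans (le_of_eq ?_)
    field_simp
  have hlim : Tendsto (fun N : ℕ => ENNReal.ofReal √(C / N)) atTop (𝓝 0) := by
    have h1 : Tendsto (fun N : ℕ => √(C / N)) atTop (𝓝 0) := by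
      have := (Real.continuous_sqrt.tendsto _).comp (tendsto_const_div_atTop_nhds_zero_nat C)
      simpa [Function.comp_def] using this
    simpa using ENNReal.tendsto_ofReal h1
  refine tendsto_of_tendsto_of_tendsto_of_le_of_le' tendsto_const_nhds hlim
    (Eventually.of_forall fun _ => zero_le) ?_
  filter_upwards [eventually_gt_atTop 0] with N hN using hbound N hN

end Statistic

end VStatistic

/-! ### Kernels for averages of products of double means. -/

namespace VStatistic

open Finset

section Block

variable {E J : Type*} [Fintype J]

/-- The kernel whose V-statistic averages, over the sample, products of empirical double means. -/
noncomputable def blockKernel (K : J → E → E → E → ℝ) (x : Unit ⊕ (J ⊕ J) → E) : ℝ :=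
  ∏ j, K j (x (.inr (.inl j))) (x (.inr (.inr j))) (x (.inl ()))

/-- Each factor j has its own two summation indices, and all factors share the `Unit` index. An
index map is then a triple (n, u, v), and distributivity turns sums over u and v into a product of
double sums. -/
theorem vStat_blockKernel [DecidableEq J] {κ : Type*} [Fintype κ] (K : J → E → E → E → ℝ)
    (z : κ → E) :
    vStat (blockKernel K) z = (∑ n, ∏ j,
      (∑ k, ∑ l, K j (z k) (z l) (z n)) / (Fintype.card κ : ℝ) ^ 2) / Fintype.card κ := by
  have h1 : ∑ f : Unit ⊕ (J ⊕ J) → κ, blockKernel K (z ∘ f) =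
      ∑ n, ∏ j, ∑ k, ∑ l, K j (z k) (z l) (z n) := by
    rw [← Equiv.sum_comp (Equiv.sumArrowEquivProdArrow _ _ _).symm, Fintype.sum_prod_type,
      ← Equiv.sum_comp (Equiv.funUnique Unit κ).symm]
    refine sum_congr rfl fun n _ => ?_
    rw [← Equiv.sum_comp (Equiv.sumArrowEquivProdArrow _ _ _).symm, Fintype.sum_prod_type,
      prod_univ_sum, Fintype.piFinset_univ]
    refine sum_congr rfl fun u _ => ?_
    rw [prod_univ_sum, Fintype.piFinset_univ]
    rfl
  unfold vStat
  rw [h1]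
  simp only [prod_div_distrib, prod_const, ← sum_div, div_div, card_univ, Fintype.card_sum,
    Fintype.card_unit]
  congr 1
  ring

theorem abs_blockKernel_le {K : J → E → E → E → ℝ} {B : ℝ} (hB : ∀ j s t p, |K j s t p| ≤ B)
    (x : Unit ⊕ (J ⊕ J) → E) : |blockKernel K x| ≤ B ^ Fintype.card J := by
  unfold blockKernel
  rw [abs_prod]
  refine (prod_le_prod (fun j _ => abs_nonneg _) fun j _ => hB j _ _ _).trans ?_
  simp

variable [MeasurableSpace E]

theorem measurable_blockKernel {K : J → E → E → E → ℝ}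
    (hK : ∀ j, Measurable fun q : E × E × E => K j q.1 q.2.1 q.2.2) :
    Measurable (blockKernel K) := by
  unfold blockKernel
  refine measurable_fun_prod _ fun j _ => ?_
  have h : Measurable fun x : Unit ⊕ (J ⊕ J) → E =>
      (x (.inr (.inl j)), x (.inr (.inr j)), x (.inl ())) := by fun_prop
  exact (hK j).comp h

/-- Given the shared argument, the factors use disjoint sets of independent arguments, so the inner
integral splits as a product. -/
theorem integral_blockKernel (P : Measure E) [IsProbabilityMeasure P] {K : J → E → E → E → ℝ}
    (hK : ∀ j, Measurable fun q : E × E × E => K j q.1 q.2.1 q.2.2) {B : ℝ}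
    (hB : ∀ j s t p, |K j s t p| ≤ B) :
    ∫ x, blockKernel K x ∂(Measure.pi fun _ => P) =
      ∫ p, ∏ j, ∫ s, ∫ t, K j s t p ∂P ∂P ∂P := by
  set ν : Measure (J → E) := Measure.pi fun _ => P with hν
  set g : E × (J → E) × (J → E) → ℝ := fun q => ∏ j, K j (q.2.1 j) (q.2.2 j) q.1 with hg
  have hgm : Measurable g := by
    refine measurable_fun_prod _ fun j _ => ?_
    have h : Measurable fun q : E × (J → E) × (J → E) => (q.2.1 j, q.2.2 j, q.1) := by fun_prop
    exact (hK j).comp h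
  have hgb : ∀ q, |g q| ≤ B ^ Fintype.card J := fun q => by
    simp only [hg]
    rw [abs_prod]
    refine (prod_le_prod (fun j _ => abs_nonneg _) fun j _ => hB j _ _ _).trans ?_
    simp
  have hT : MeasurePreserving
      (fun x : Unit ⊕ (J ⊕ J) → E => (x (.inl ()), (fun j => x (.inr (.inl j))),
        fun j => x (.inr (.inr j)))) (Measure.pi fun _ => P) (P.prod (ν.prod ν)) :=
    ((measurePreserving_funUnique P Unit).prod
      (measurePreserving_sumPiEquivProdPi (fun _ : J ⊕ J => P))).comp
      (measurePreserving_sumPiEquivProdPi (fun _ : Unit ⊕ (J ⊕ J) => P))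
  have h1 : ∫ x, blockKernel K x ∂(Measure.pi fun _ => P) = ∫ q, g q ∂(P.prod (ν.prod ν)) :=
    integral_comp_eq hT hgm
  rw [h1, integral_prod _ (integrable_of_bounded hgm hgb)]
  refine integral_congr_ae (ae_of_all _ fun p => ?_)
  have hgp : Measurable fun q : (J → E) × (J → E) => g (p, q) := hgm.comp measurable_prodMk_left
  simp only
  rw [integral_prod _ (integrable_of_bounded hgp fun q => hgb _)]
  simp only [hg, hν]
  rw [← integral_fintype_prod_eq_prod (𝕜 := ℝ) (fun j s => ∫ t, K j s t p ∂P)]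
  refine integral_congr_ae (ae_of_all _ fun s => ?_)
  exact integral_fintype_prod_eq_prod (𝕜 := ℝ) (fun j t => K j (s j) t p)

end Block

end VStatistic

/-! ### Rank moments as rescaled V-statistics. -/

namespace RankCorr

open Finset VStatistic

/-- The comparison kernel of the rank transformation. -/
noncomputable def comparison (s t : ℝ) : ℝ := if s < t then 1 else -1

theorem abs_comparison (s t : ℝ) : |comparison s t| = 1 := by
  unfold comparison
  split_ifs <;> simp

theorem measurable_comparison : Measurable fun p : ℝ × ℝ => comparison p.1 p.2 :=
  Measurable.ite (measurableSet_lt measurable_fst measurable_snd) measurable_const measurable_const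

/-- The comparison is -1 on the diagonal, where the score is 0. Hence the correction term. -/
theorem neg_score_eq {N : ℕ} (x : Fin N → ℝ) (k l : Fin N) :
    -score x k l = comparison (x k) (x l) + if k = l then 1 else 0 := by
  unfold score comparison
  by_cases h : k = l
  · simp [h]
  · by_cases h' : x l ≤ x k
    · simp [h, h', not_lt.2 h']
    · simp [h, h', not_le.1 h']

theorem rankTransform_eq_comparison {N : ℕ} (hN : 2 ≤ N) (x : Fin N → ℝ) (l : Fin N) :
    rankTransform x l = (∑ k, comparison (x k) (x l) + 1) / ((N : ℝ) - 1) := by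
  rw [rankTransform_eq hN]
  simp [neg_score_eq, sum_add_distrib]

/-- The diagonal correction is the same for every l, so centring removes it and unrestricted double
sums remain. -/
theorem rankTransform_sub_mean {N : ℕ} (hN : 2 ≤ N) (x : Fin N → ℝ) (l : Fin N) :
    rankTransform x l - mean (rankTransform x) = (N / ((N : ℝ) - 1)) *
      ((∑ k, ∑ m, (comparison (x k) (x l) - comparison (x k) (x m))) / (N : ℝ) ^ 2) := by
  have h2 : (2 : ℝ) ≤ N := by exact_mod_cast hN
  have h1 : (N : ℝ) - 1 ≠ 0 := by linarith
  have h0 : (N : ℝ) ≠ 0 := by linarith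
  unfold mean
  simp only [rankTransform_eq_comparison hN, ← sum_div, sum_add_distrib, sum_sub_distrib,
    sum_const, card_univ, Fintype.card_fin, nsmul_eq_mul, ← mul_sum]
  rw [sum_comm (f := fun k m => comparison (x k) (x m))]
  field_simp
  ring

/-- The coordinate of an observation used by a factor of a joint moment. -/
noncomputable def coord {a b : ℕ} (j : Fin a ⊕ Fin b) (p : ℝ × ℝ) : ℝ := Sum.elim (fun _ => p.1) (fun _ => p.2) j

theorem measurable_coord {a b : ℕ} (j : Fin a ⊕ Fin b) : Measurable (coord j) := by
  cases j
  · exact measurable_fst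
  · exact measurable_snd

/-- The factors of the kernel of a joint rank moment. -/
noncomputable def momentFactor (a b : ℕ) (j : Fin a ⊕ Fin b) (s t p : ℝ × ℝ) : ℝ :=
  comparison (coord j s) (coord j p) - comparison (coord j s) (coord j t)

theorem abs_momentFactor_le (a b : ℕ) (j : Fin a ⊕ Fin b) (s t p : ℝ × ℝ) :
    |momentFactor a b j s t p| ≤ 2 := by
  refine (abs_sub _ _).trans ?_
  rw [abs_comparison, abs_comparison]
  norm_num

theorem measurable_momentFactor (a b : ℕ) (j : Fin a ⊕ Fin b) :
    Measurable fun q : (ℝ × ℝ) × (ℝ × ℝ) × (ℝ × ℝ) => momentFactor a b j q.1 q.2.1 q.2.2 := by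
  have hc := measurable_coord j
  exact (measurable_comparison.comp ((hc.comp measurable_fst).prodMk
    (hc.comp (measurable_snd.comp measurable_snd)))).sub
    (measurable_comparison.comp ((hc.comp measurable_fst).prodMk
    (hc.comp (measurable_fst.comp measurable_snd))))

/-- Sample joint rank moments are rescaled V-statistics. -/
theorem sampleJointMoment_eq {N : ℕ} (hN : 2 ≤ N) (a b : ℕ) (z : Fin N → ℝ × ℝ) :
    sampleJointMoment a b (fun n => (z n).1) (fun n => (z n).2) =
      (N / ((N : ℝ) - 1)) ^ (a + b + 1) * vStat (blockKernel (momentFactor a b)) z := by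
  have h2 : (2 : ℝ) ≤ N := by exact_mod_cast hN
  have h1 : (N : ℝ) - 1 ≠ 0 := by linarith
  have h0 : (N : ℝ) ≠ 0 := by linarith
  unfold sampleJointMoment
  rw [vStat_blockKernel]
  simp only [Fintype.prod_sum_type, momentFactor, coord, Sum.elim_inl, Sum.elim_inr, prod_const,
    card_univ, Fintype.card_fin, rankTransform_sub_mean hN, mul_pow]
  -- Each of the a + b centred ranks contributes one factor N/(N-1). The last comes from dividing by
  -- N - 1 instead of N.
  simp_rw [mul_mul_mul_comm _ _ ((N / ((N : ℝ) - 1)) ^ b), ← pow_add, ← mul_sum]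
  rw [pow_succ _ (a + b)]
  generalize ((N : ℝ) / ((N : ℝ) - 1)) ^ (a + b) = q
  field_simp

theorem integral_comparison {α : Type*} [MeasurableSpace α] (P : Measure α)
    [IsProbabilityMeasure P] {c : α → ℝ} (hc : Measurable c) (t : ℝ) :
    ∫ s, comparison (c s) t ∂P = popRank (P.map c) t := by
  have hm : Measurable fun s => comparison s t := measurable_comparison.comp measurable_prodMk_right
  have : IsProbabilityMeasure (P.map c) := Measure.isProbabilityMeasure_map hc.aemeasurable
  rw [← integral_map (f := fun s => comparison s t) hc.aemeasurable hm.aestronglyMeasurable]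
  have h : (fun s => comparison s t) = fun s =>
      (Set.Iio t).indicator 1 s - (Set.Ici t).indicator (1 : ℝ → ℝ) s := by
    funext s
    unfold comparison
    by_cases hs : s < t
    · simp [hs]
    · simp [hs, not_lt.1 hs]
  rw [h, integral_sub, integral_indicator_one measurableSet_Iio,
    integral_indicator_one measurableSet_Ici]
  · rfl
  · exact (integrable_const (1 : ℝ)).indicator measurableSet_Iio
  · exact (integrable_const (1 : ℝ)).indicator measurableSet_Ici

theorem integral_integral_momentFactor (P : Measure (ℝ × ℝ)) [IsProbabilityMeasure P] (a b : ℕ)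
    (j : Fin a ⊕ Fin b) (p : ℝ × ℝ) :
    ∫ s, ∫ t, momentFactor a b j s t p ∂P ∂P = popRank (P.map (coord j)) (coord j p) -
      ∫ t, popRank (P.map (coord j)) t ∂(P.map (coord j)) := by
  have hc := measurable_coord j
  have hm2 : Measurable fun q : (ℝ × ℝ) × (ℝ × ℝ) => comparison (coord j q.1) (coord j q.2) :=
    measurable_comparison.comp ((hc.comp measurable_fst).prodMk (hc.comp measurable_snd))
  have hb : ∀ q : (ℝ × ℝ) × (ℝ × ℝ), |comparison (coord j q.1) (coord j q.2)| ≤ 1 := fun q =>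
    (abs_comparison _ _).le
  have hi2 := integrable_of_bounded (ν := P.prod P) hm2 hb
  have h1 : ∀ s, ∫ t, momentFactor a b j s t p ∂P =
      comparison (coord j s) (coord j p) - ∫ t, comparison (coord j s) (coord j t) ∂P :=
    fun s => by
      unfold momentFactor
      rw [integral_sub (integrable_const _)
        (integrable_of_bounded (f := fun t => comparison (coord j s) (coord j t))
          (hm2.comp measurable_prodMk_left) fun t => hb (s, t))]
      simp
  have hpr : Measurable (popRank (P.map (coord j))) := by
    have : popRank (P.map (coord j)) = fun t => ∫ s, comparison (coord j s) t ∂P :=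
      funext fun t => (integral_comparison P hc t).symm
    rw [this]
    have h : Measurable fun q : ℝ × (ℝ × ℝ) => comparison (coord j q.2) q.1 :=
      measurable_comparison.comp ((hc.comp measurable_snd).prodMk measurable_fst)
    exact h.stronglyMeasurable.integral_prod_right'.measurable
  simp only [h1]
  rw [integral_sub (integrable_of_bounded (f := fun s => comparison (coord j s) (coord j p))
      (hm2.comp measurable_prodMk_right) fun s => hb (s, p))
    hi2.integral_prod_left, integral_comparison P hc, integral_integral_swap hi2,
    integral_map hc.aemeasurable hpr.aestronglyMeasurable]
  simp only [integral_comparison P hc]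

theorem integral_blockKernel_momentFactor (P : Measure (ℝ × ℝ)) [IsProbabilityMeasure P]
    (a b : ℕ) :
    ∫ x, blockKernel (momentFactor a b) x ∂(Measure.pi fun _ => P) = popJointMoment P a b := by
  rw [integral_blockKernel P (measurable_momentFactor a b) (abs_momentFactor_le a b)]
  simp only [integral_integral_momentFactor, Fintype.prod_sum_type]
  have h1 : ∀ i : Fin a, coord (b := b) (Sum.inl i) = Prod.fst := fun i => rfl
  have h2 : ∀ i : Fin b, coord (a := a) (Sum.inr i) = Prod.snd := fun i => rfl
  simp only [h1, h2, prod_const, card_univ, Fintype.card_fin]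
  rfl

theorem measurable_rankTransform {N : ℕ} (l : Fin N) :
    Measurable fun x : Fin N → ℝ => rankTransform x l := by
  have hs : ∀ k l : Fin N, Measurable fun x : Fin N → ℝ => score x k l := fun k l => by
    have : (fun x : Fin N → ℝ => score x k l) = fun x =>
        -(comparison (x k) (x l) + if k = l then 1 else 0) := by
      funext x
      rw [← neg_score_eq, neg_neg]
    rw [this]
    have h : Measurable fun x : Fin N → ℝ => (x k, x l) := by fun_prop
    exact ((measurable_comparison.comp h).add_const _).neg
  unfold rankTransform centredScore rowMean colMean grandMean
  fun_prop

theorem measurable_sampleJointMoment (a b N : ℕ) :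
    Measurable fun z : Fin N → ℝ × ℝ =>
      sampleJointMoment a b (fun n => (z n).1) (fun n => (z n).2) := by
  have h1 : ∀ l : Fin N, Measurable fun z : Fin N → ℝ × ℝ => rankTransform (fun n => (z n).1) l :=
    fun l => (measurable_rankTransform l).comp (by fun_prop)
  have h2 : ∀ l : Fin N, Measurable fun z : Fin N → ℝ × ℝ => rankTransform (fun n => (z n).2) l :=
    fun l => (measurable_rankTransform l).comp (by fun_prop)
  have m1 : Measurable fun z : Fin N → ℝ × ℝ => mean (rankTransform fun n => (z n).1) :=
    (measurable_fun_sum _ fun l _ => h1 l).div_const _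
  have m2 : Measurable fun z : Fin N → ℝ × ℝ => mean (rankTransform fun n => (z n).2) :=
    (measurable_fun_sum _ fun l _ => h2 l).div_const _
  exact (measurable_fun_sum _ fun l _ => (((h1 l).sub m1).pow_const a).mul
    (((h2 l).sub m2).pow_const b)).div_const _

/-- The scaling factors relating unbiased normalisations to averages are `1 + O(1 / N)`. -/
theorem tendsto_sqrt_mul_ratio_pow_sub_one (m : ℕ) :
    Tendsto (fun N : ℕ => √N * (((N : ℝ) / ((N : ℝ) - 1)) ^ m - 1)) atTop (𝓝 0) := by
  have hN : Tendsto (fun N : ℕ => (N : ℝ) - 1) atTop atTop :=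
    tendsto_atTop_add_const_right _ _ tendsto_natCast_atTop_atTop
  have hr : Tendsto (fun N : ℕ => (N : ℝ) / ((N : ℝ) - 1)) atTop (𝓝 1) := by
    have h := (tendsto_inv_atTop_zero.comp hN).const_add 1
    rw [add_zero] at h
    refine h.congr' ?_
    filter_upwards [eventually_ge_atTop 2] with N h2
    have h2' : (2 : ℝ) ≤ N := by exact_mod_cast h2
    have h1 : (N : ℝ) - 1 ≠ 0 := by linarith
    simp only [Function.comp_apply]
    field_simp
    ring
  have hs : Tendsto (fun N : ℕ => √N * ((N : ℝ) / ((N : ℝ) - 1) - 1)) atTop (𝓝 0) := by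
    have h0 : Tendsto (fun N : ℕ => (√(N : ℝ))⁻¹) atTop (𝓝 0) :=
      tendsto_inv_atTop_zero.comp (Real.tendsto_sqrt_atTop.comp tendsto_natCast_atTop_atTop)
    -- With r = N/(N-1), √N (r - 1) = N^(-1/2) r. Powers follow from r^m - 1 = (r - 1)(1 + r + ... +
    -- r^(m-1)).
    have h := h0.mul hr
    rw [zero_mul] at h
    refine h.congr' ?_
    filter_upwards [eventually_ge_atTop 2] with N h2
    have h2' : (2 : ℝ) ≤ N := by exact_mod_cast h2
    have h1 : (N : ℝ) - 1 ≠ 0 := by linarith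
    have hpos : √(N : ℝ) ≠ 0 := (Real.sqrt_pos.2 (by linarith)).ne'
    have hsq : √(N : ℝ) ^ 2 = N := Real.sq_sqrt (by linarith)
    field_simp
    rw [hsq]
    ring
  have h := hs.mul (tendsto_finsetSum (range m) fun i _ => hr.pow i)
  rw [zero_mul] at h
  refine h.congr fun N => ?_
  rw [mul_assoc, mul_comm ((N : ℝ) / ((N : ℝ) - 1) - 1), geom_sum_mul]

/-- Sample joint rank moments of an i.i.d. sample are asymptotically linear. -/
theorem isAsympLinear_sampleJointMoment {Ω : Type*} [MeasurableSpace Ω] {μ : Measure Ω}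
    [IsProbabilityMeasure μ] {Z : ℕ → Ω → ℝ × ℝ} (hZ : ∀ n, Measurable (Z n))
    (hindep : iIndepFun Z μ) (hident : ∀ n, IdentDistrib (Z n) (Z 0) μ μ) (a b : ℕ) :
    IsAsympLinear μ Z
      (fun N ω => sampleJointMoment a b (fun n : Fin N => (Z n ω).1) (fun n : Fin N => (Z n ω).2))
      (popJointMoment (μ.map (Z 0)) a b)
      (influence (μ.map (Z 0)) (blockKernel (momentFactor a b))) := by
  have : IsProbabilityMeasure (μ.map (Z 0)) :=
    Measure.isProbabilityMeasure_map (hZ 0).aemeasurable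
  have hb := abs_blockKernel_le (abs_momentFactor_le a b)
  have h := isAsympLinear_vStat hZ hindep hident
    (measurable_blockKernel (measurable_momentFactor a b)) hb
  rw [integral_blockKernel_momentFactor] at h
  have hsample : ∀ N : ℕ, Measurable fun ω => fun n : Fin N => Z n ω := fun N => by fun_prop
  have hm : ∀ N : ℕ, Measurable fun ω =>
      sampleJointMoment a b (fun n : Fin N => (Z n ω).1) (fun n : Fin N => (Z n ω).2) := fun N =>
    (measurable_sampleJointMoment a b N).comp (hsample N)
  have hV : ∀ (N : ℕ) ω, |vStat (blockKernel (momentFactor a b)) fun n : Fin N => Z n ω| ≤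
      2 ^ Fintype.card (Fin a ⊕ Fin b) := fun N ω => abs_vStat_le hb (by positivity) _
  refine h.of_eventually_eq_mul hZ hV (tendsto_sqrt_mul_ratio_pow_sub_one (a + b + 1)) hm
    (fun N => ?_) ?_
  · by_cases hN : 2 ≤ N
    · have heq := fun ω => sampleJointMoment_eq hN a b fun n : Fin N => Z n ω
      simp only [heq]
      exact (h.memLp N).const_mul _
    -- For N = 0 the sum is empty. For N = 1 the division by N - 1 = 0 gives 0 by convention.
    · have h0 : (fun ω => sampleJointMoment a b (fun n : Fin N => (Z n ω).1)
          (fun n : Fin N => (Z n ω).2)) = fun _ => 0 := by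
        funext ω
        unfold sampleJointMoment
        interval_cases N <;> simp
      rw [h0]
      exact memLp_const 0
  · filter_upwards [eventually_ge_atTop 2] with N hN ω using
      sampleJointMoment_eq hN a b fun n : Fin N => Z n ω

/-- The rank correlation statistic of an i.i.d. sample is asymptotically linear. -/
theorem exists_isAsympLinear_rhoHat {Ω : Type*} [MeasurableSpace Ω] {μ : Measure Ω}
    [IsProbabilityMeasure μ] {Z : ℕ → Ω → ℝ × ℝ} (hZ : ∀ n, Measurable (Z n))
    (hindep : iIndepFun Z μ) (hident : ∀ n, IdentDistrib (Z n) (Z 0) μ μ) (w : ℕ → ℕ → ℝ) :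
    ∃ ψ, IsAsympLinear μ Z
      (fun N ω => rhoHat w (fun n : Fin N => (Z n ω).1) (fun n : Fin N => (Z n ω).2))
      (rho w (μ.map (Z 0))) ψ := by
  have h := IsAsympLinear.sum (μ := μ) hZ (Icc 2 4) fun r _ =>
    IsAsympLinear.sum hZ (HasAntidiagonal.antidiagonal r) fun p _ =>
      (isAsympLinear_sampleJointMoment hZ hindep hident p.1 p.2).const_mul (w p.1 p.2)
  unfold rhoHat rho
  exact ⟨_, h⟩

end RankCorr

/-! ### The main theorem. -/

theorem mainTheorem9 {Ω : Type*} [MeasurableSpace Ω] (μ : Measure Ω) [IsProbabilityMeasure μ]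
    (X Y : ℕ → Ω → ℝ) (hX : ∀ n, Measurable (X n)) (hY : ∀ n, Measurable (Y n))
    (hindep : iIndepFun (fun n ω => (X n ω, Y n ω)) μ)
    (hident : ∀ n, IdentDistrib (fun ω => (X n ω, Y n ω)) (fun ω => (X 0 ω, Y 0 ω)) μ μ)
    (w : ℕ → ℕ → ℝ) :
    ∃ σ2 : ℝ≥0,
      Tendsto (fun N : ℕ => (N : ℝ) *
        variance (fun ω => RankCorr.rhoHat w (fun n : Fin N => X n ω) (fun n : Fin N => Y n ω)) μ)
        atTop (𝓝 (σ2 : ℝ)) ∧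
      TendstoInDistribution
        (fun (N : ℕ) ω => Real.sqrt N *
          (RankCorr.rhoHat w (fun n : Fin N => X n ω) (fun n : Fin N => Y n ω) -
            RankCorr.rho w (μ.map (fun ω => (X 0 ω, Y 0 ω)))))
        atTop (id : ℝ → ℝ) (fun _ => μ) (gaussianReal 0 σ2) := by
  have hZ : ∀ n, Measurable fun ω => (X n ω, Y n ω) := fun n => (hX n).prodMk (hY n)
  obtain ⟨ψ, h⟩ := RankCorr.exists_isAsympLinear_rhoHat hZ hindep hident w
  dsimp only at h
  have hvar := h.tendsto_variance hZ hindep hident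
  -- This puts the variance limit in the nonnegative form used by the Gaussian law, so one σ² serves
  -- both claims.
  rw [← Real.coe_toNNReal _ (variance_nonneg _ _)] at hvar
  have hdist := h.tendstoInDistribution hZ hindep hident
  exact ⟨_, hvar, hdist⟩
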